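/- **Theorem 6.6.** Let $R$ be a commutative Noetherian ring and $M$ a finitely generated $R$-module. For an ideal $J$ of $R$ put $r(J,M)=\bigcup_{k\ge 1}(J^{k+1}M :_R J^kM)$ and $\widetilde{J}=\bigcup_{k\ge 1}(J^{k+1}:J^k)=r(J,R)$ (both are unions of ascending chains of ideals, and $\widetilde J\subseteq r(J,M)$). Let $\operatorname{m-Spec}R$ be the set of maximal ideals of $R$, and assume that 1. $\operatorname{Ass}R\cap\operatorname{m-Spec}R=\emptyset$, and 2. for every prime ideal $\mathfrak p$ of $R$ that is not maximal, $M_{\mathfrak p}$ is a nonzero free $R_{\mathfrak p}$-module. Let $I$ be a regular ideal of $R$, i.e. an ideal that contains a non-zero-divisor of $R$. Then for every $n\ge 1$ the $R$-module $r(I^n,M)/\widetilde{I^n}$ has finite length, and there is a polynomial $P\in\mathbb{Q}[X]$ such that $\ell\bigl(r(I^n,M)/\widetilde{I^n}\bigr)=P(n)$ for all sufficiently large $n$. Moreover, let $A^*(I)$ be the stable value of the sequence $\operatorname{Ass}(R/I^n)$, i.e. the set of primes that belong to $\operatorname{Ass}(R/I^n)$ for all sufficiently large $n$. If $A^*(I)\cap\operatorname{m-Spec}R=\emptyset$,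 then $r(I^n,M)=\widetilde{I^n}$ for all $n\ge 1$. -/

import Mathlib

universe u v

open Filter Polynomial

/-- The chain `(I^{k+1} M : I^k M)`, `k = 0, 1, 2, …`, of ideals of `R`. -/
def ratliffRushChain {R : Type u} [CommRing R] (I : Ideal R)
    (M : Type v) [AddCommGroup M] [Module R M] (k : ℕ) : Ideal R :=
  (I ^ (k + 1) • (⊤ : Submodule R M)).colon ((I ^ k • (⊤ : Submodule R M) : Submodule R M) : Set M)

/-- The Ratliff-Rush ideal associated with `I` and `M`,
`r(I, M) = ⋃_{k ≥ 1} (I^{k+1} M : I^k M)`.  The chain is ascending, so the supremum is the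
union; see `mem_ratliffRushIdeal`. -/
def ratliffRushIdeal {R : Type u} [CommRing R] (I : Ideal R)
    (M : Type v) [AddCommGroup M] [Module R M] : Ideal R :=
  ⨆ k : ℕ, ⨆ _ : 1 ≤ k, ratliffRushChain I M k

/-- The Ratliff-Rush closure `Ĩ = ⋃_{k ≥ 1} (I^{k+1} : I^k)`, that is, `r(I, R)`. -/
def ratliffRushClosure {R : Type u} [CommRing R] (I : Ideal R) : Ideal R :=
  ratliffRushIdeal I R

theorem mem_ratliffRushChain {R : Type u} [CommRing R] (I : Ideal R)
    (M : Type v) [AddCommGroup M] [Module R M] (k : ℕ) (x : R) :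
    x ∈ ratliffRushChain I M k ↔
      ∀ m ∈ I ^ k • (⊤ : Submodule R M), x • m ∈ I ^ (k + 1) • (⊤ : Submodule R M) := by
  unfold ratliffRushChain
  rw [Submodule.mem_colon]
  rfl

theorem ratliffRushChain_mono {R : Type u} [CommRing R] (I : Ideal R)
    (M : Type v) [AddCommGroup M] [Module R M] : Monotone (ratliffRushChain I M) := by
  refine monotone_nat_of_le_succ fun k x hx => ?_
  rw [mem_ratliffRushChain] at hx ⊢
  intro m hm
  rw [pow_succ', mul_smul] at hm
  rw [pow_succ' I (k + 1), mul_smul]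
  refine Submodule.smul_induction_on hm ?_ ?_
  · intro r hr n hn
    rw [smul_comm x r n]
    exact Submodule.smul_mem_smul hr (hx n hn)
  · intro a b ha hb
    rw [smul_add]
    exact add_mem ha hb

theorem mem_ratliffRushIdeal {R : Type u} [CommRing R] (I : Ideal R)
    (M : Type v) [AddCommGroup M] [Module R M] (x : R) :
    x ∈ ratliffRushIdeal I M ↔
      ∃ k : ℕ, 1 ≤ k ∧
        ∀ m ∈ I ^ k • (⊤ : Submodule R M), x • m ∈ I ^ (k + 1) • (⊤ : Submodule R M) := by
  constructor
  · intro hx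
    have hle : ratliffRushIdeal I M ≤ ⨆ k : ℕ, ratliffRushChain I M k :=
      iSup_le fun k => iSup_le fun _ => le_iSup (ratliffRushChain I M) k
    obtain ⟨k, hk⟩ := (Submodule.mem_iSup_of_directed _
      (ratliffRushChain_mono I M).directed_le).1 (hle hx)
    exact ⟨k + 1, by omega, (mem_ratliffRushChain I M (k + 1) x).1
      (ratliffRushChain_mono I M (Nat.le_succ k) hk)⟩
  · rintro ⟨k, hk, h⟩
    exact (le_iSup₂_of_le k hk le_rfl : ratliffRushChain I M k ≤ ratliffRushIdeal I M)
      ((mem_ratliffRushChain I M k x).2 h)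

theorem mem_ratliffRushClosure {R : Type u} [CommRing R] (I : Ideal R) (x : R) :
    x ∈ ratliffRushClosure I ↔ ∃ k : ℕ, 1 ≤ k ∧ ∀ a ∈ I ^ k, x * a ∈ I ^ (k + 1) := by
  unfold ratliffRushClosure
  rw [mem_ratliffRushIdeal]
  simp [smul_eq_mul]

/-- `Ĩ ⊆ r(I, M)`. -/
theorem ratliffRushClosure_le_ratliffRushIdeal {R : Type u} [CommRing R] (I : Ideal R)
    (M : Type v) [AddCommGroup M] [Module R M] :
    ratliffRushClosure I ≤ ratliffRushIdeal I M := by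
  intro x hx
  rw [mem_ratliffRushClosure] at hx
  rw [mem_ratliffRushIdeal]
  obtain ⟨k, hk, h⟩ := hx
  refine ⟨k, hk, fun m hm => ?_⟩
  refine Submodule.smul_induction_on hm ?_ ?_
  · intro r hr n hn
    rw [← mul_smul]
    exact Submodule.smul_mem_smul (h r hr) hn
  · intro a b ha hb
    rw [smul_add]
    exact add_mem ha hb

/-- The length of the `R`-module `r(I, M) / Ĩ`.  (Since `Ĩ ⊆ r(I, M)`, the submodule
`Submodule.submoduleOf` of `r(I, M)` is `Ĩ` itself.) -/
noncomputable def ratliffRushLength {R : Type u} [CommRing R] (I : Ideal R)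
    (M : Type v) [AddCommGroup M] [Module R M] : ℕ∞ :=
  Module.length R
    (↥(ratliffRushIdeal I M) ⧸ (ratliffRushClosure I).submoduleOf (ratliffRushIdeal I M))

/-- `A*(I)`, the stable value of the sequence `Ass (R / I^n)`: the primes that belong to
`Ass (R / I^n)` for all large `n`; see `asymptoticPrimes_eq`. -/
def asymptoticPrimes {R : Type u} [CommRing R] (I : Ideal R) : Set (Ideal R) :=
  {p | ∀ᶠ n : ℕ in atTop, p ∈ associatedPrimes R (R ⧸ I ^ n)}

theorem asymptoticPrimes_eq {R : Type u} [CommRing R] (I : Ideal R) (A : Set (Ideal R))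
    (hA : ∀ᶠ n : ℕ in atTop, associatedPrimes R (R ⧸ I ^ n) = A) : asymptoticPrimes I = A := by
  ext p
  constructor
  · intro hp
    obtain ⟨n, h1, h2⟩ := (Filter.Eventually.and hp hA).exists
    exact h2 ▸ h1
  · intro hp
    exact hA.mono fun n hn => hn ▸ hp

/-- `m-Spec R`, the set of maximal ideals of `R`. -/
def maxIdeals (R : Type u) [CommRing R] : Set (Ideal R) :=
  {m | m.IsMaximal}

/-- A regular ideal: an ideal that contains a non-zero-divisor of `R`. -/
def IsRegularIdeal {R : Type u} [CommRing R] (I : Ideal R) : Prop :=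
  ∃ x ∈ I, x ∈ nonZeroDivisors R

/-! ### Eventually polynomial sequences -/

/-! Everything rests on the trace ideal `T` of `M`. At a non-maximal prime a coordinate form of the
free module lifts, up to a unit, to a form on `M` with a value outside the prime; so only maximal
ideals can contain `T`. A form on `M` carries `x J^k M ⊆ J^(k+1) M` into `R`, whence `T r(J, M) ⊆
J̃`. Thus `r(J, M) / J̃` is a finite module over the Artinian ring `R / T` and has finite length.

As no associated prime of `R` is maximal, none contains `T`, and `M` is faithful. Artin–Rees then
gives, for large `n`, `r(I^n, M) = I^(n-c) J` and `(I^n)~ = I^n`. The quotients are therefore the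
graded pieces of a subquotient of the Rees algebra, and Hilbert–Serre yields the polynomial.

If some `x ∈ r(I^n, M)` is not in `(I^n)~`, its class is killed by `T`, so an associated prime of `R
/ (I^n)~` contains `T`. That prime is maximal, and a maximal associated prime of `R / (I^n)~`
persists in `Ass (R / I^N)` for all large `N`. -/

theorem Polynomial.exists_forall_eval_add_one_sub_eval_eq (P : ℚ[X]) :
    ∃ Q : ℚ[X], ∀ x : ℚ, Q.eval (x + 1) - Q.eval x = P.eval x := by
  induction P using Polynomial.induction_on' with
  | add p q hp hq =>
    obtain ⟨P, hP⟩ := hp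
    obtain ⟨Q, hQ⟩ := hq
    refine ⟨P + Q, fun x => ?_⟩
    rw [eval_add, eval_add, eval_add, ← hP, ← hQ]
    ring
  | monomial n a =>
    -- Bernoulli polynomials satisfy `B_(n+1)(x + 1) - B_(n+1)(x) = (n + 1) x^n`.
    refine ⟨C (a / (n + 1)) * Polynomial.bernoulli (n + 1), fun x => ?_⟩
    have h := Polynomial.bernoulli_eval_one_add (n + 1) x
    have hn : (n : ℚ) + 1 ≠ 0 := by positivity
    rw [add_comm] at h
    rw [eval_mul, eval_mul, h, eval_monomial, eval_C, eval_C, Nat.add_sub_cancel]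
    push_cast
    field_simp
    ring

theorem exists_polynomial_of_eventually_succ_sub {f : ℕ → ℚ} {P : ℚ[X]}
    (h : ∀ᶠ n : ℕ in atTop, f (n + 1) - f n = P.eval (n : ℚ)) :
    ∃ Q : ℚ[X], ∀ᶠ n : ℕ in atTop, f n = Q.eval (n : ℚ) := by
  obtain ⟨Q, hQ⟩ := Polynomial.exists_forall_eval_add_one_sub_eval_eq P
  obtain ⟨N, hN⟩ := eventually_atTop.1 h
  refine ⟨Q + C (f N - Q.eval (N : ℚ)), eventually_atTop.2 ⟨N, fun n hn => ?_⟩⟩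
  induction n, hn using Nat.le_induction with
  | base => simp
  | succ n hn ih =>
    have h1 := hN n hn
    have h2 := hQ n
    simp only [eval_add, eval_C] at ih ⊢
    push_cast
    linarith

/-! ### Relative length of ideals -/

section RelLength

variable {R : Type u} [CommRing R]

/-- The length of `A / (A ∩ B)`. -/
noncomputable def relLength (A B : Ideal R) : ℕ∞ :=
  Module.length R (↥A ⧸ B.submoduleOf A)

theorem relLength_self (A : Ideal R) : relLength A A = 0 := by
  unfold relLength
  rw [Module.length_eq_zero_iff, Submodule.submoduleOf_self]
  infer_instance

theorem relLength_eq_add {A B D : Ideal R} (hBD : B ≤ D) (hDA : D ≤ A) :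
    relLength A B = relLength A D + relLength D B := by
  unfold relLength
  rw [add_comm]
  have h₁ : B.submoduleOf D ≤ (B.submoduleOf A).comap (Submodule.inclusion hDA) :=
    fun x hx => hx
  have h₂ : B.submoduleOf A ≤ (D.submoduleOf A).comap LinearMap.id := fun x hx => hBD hx
  refine Module.length_eq_add_of_exact
    (Submodule.mapQ (B.submoduleOf D) (B.submoduleOf A) (Submodule.inclusion hDA)
      h₁)
    (Submodule.mapQ (B.submoduleOf A) (D.submoduleOf A) LinearMap.id
      h₂) ?_ ?_ ?_
  · rw [← LinearMap.ker_eq_bot, LinearMap.ker_eq_bot']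
    intro x
    obtain ⟨x, rfl⟩ := Submodule.Quotient.mk_surjective _ x
    intro hx
    rw [Submodule.mapQ_apply, Submodule.Quotient.mk_eq_zero] at hx
    rw [Submodule.Quotient.mk_eq_zero]
    exact hx
  · intro x
    obtain ⟨x, rfl⟩ := Submodule.Quotient.mk_surjective _ x
    exact ⟨Submodule.Quotient.mk x, rfl⟩
  · intro x
    obtain ⟨x, rfl⟩ := Submodule.Quotient.mk_surjective _ x
    rw [Submodule.mapQ_apply, Submodule.Quotient.mk_eq_zero]
    constructor
    · intro hx
      exact ⟨Submodule.Quotient.mk ⟨x, hx⟩, rfl⟩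
    · rintro ⟨y, hy⟩
      obtain ⟨y, rfl⟩ := Submodule.Quotient.mk_surjective _ y
      rw [Submodule.mapQ_apply, Submodule.Quotient.eq] at hy
      have h1 : (y : R) - x ∈ B := hy
      have h2 := sub_mem y.2 (hBD h1)
      rw [sub_sub_cancel] at h2
      exact h2

/-- Multiplication by `a` identifies `A / (A ∩ (B : a))` with `(a A + B) / B`. -/
theorem relLength_inf_comap_mul (A B : Ideal R) (a : R) :
    relLength A (A ⊓ Submodule.comap (LinearMap.mulLeft R a) B) =
      relLength (Ideal.span {a} * A ⊔ B) B := by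
  unfold relLength
  have hmem : ∀ x ∈ A, LinearMap.mulLeft R a x ∈ Ideal.span {a} * A ⊔ B := fun x hx =>
    Submodule.mem_sup_left (Ideal.mul_mem_mul (Ideal.mem_span_singleton_self a) hx)
  let f : A →ₗ[R] (↥(Ideal.span {a} * A ⊔ B) ⧸ B.submoduleOf (Ideal.span {a} * A ⊔ B)) :=
    (Submodule.mkQ _).comp ((LinearMap.mulLeft R a).restrict hmem)
  have hf : Function.Surjective f := by
    intro y
    obtain ⟨⟨y, hy⟩, rfl⟩ := Submodule.Quotient.mk_surjective _ y
    obtain ⟨z, hz, b, hb, rfl⟩ := Submodule.mem_sup.1 hy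
    obtain ⟨x, hx, rfl⟩ := Ideal.mem_span_singleton_mul.1 hz
    refine ⟨⟨x, hx⟩, ?_⟩
    change Submodule.Quotient.mk _ = _
    rw [Submodule.Quotient.eq]
    change a * x - (a * x + b) ∈ B
    rw [sub_add_cancel_left]
    exact neg_mem hb
  have hker : LinearMap.ker f =
      (A ⊓ Submodule.comap (LinearMap.mulLeft R a) B).submoduleOf A := by
    ext x
    rw [LinearMap.mem_ker]
    change Submodule.Quotient.mk _ = _ ↔ _
    rw [Submodule.Quotient.mk_eq_zero]
    exact ⟨fun h => Submodule.mem_inf.2 ⟨x.2, h⟩, fun h => (Submodule.mem_inf.1 h).2⟩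
  rw [← hker]
  exact (f.quotKerEquivOfSurjective hf).length_eq

end RelLength

/-! ### Hilbert polynomials of subquotients of the Rees algebra -/

section Hilbert

variable {R : Type u} [CommRing R]

/-- Families of ideals `W m ≤ I ^ m` with `I * W m ≤ W (m + 1)`: the homogeneous ideals of the
Rees algebra of `I`. -/
abbrev ReesFamily (I : Ideal R) : Type u :=
  {W : ℕ → Ideal R // ∀ m, W m ≤ I ^ m ∧ I * W m ≤ W (m + 1)}

theorem ReesFamily.pow_mul_le {I : Ideal R} (W : ReesFamily I) (i j : ℕ) :
    I ^ i * W.1 j ≤ W.1 (i + j) := by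
  induction i with
  | zero => simp
  | succ i ih =>
    rw [pow_succ', mul_assoc, add_right_comm]
    exact (Ideal.mul_mono_right ih).trans (W.2 _).2

/-- The ideal of the Rees algebra with given homogeneous components. -/
def ReesFamily.toIdeal {I : Ideal R} (W : ReesFamily I) : Ideal (reesAlgebra I) where
  carrier := {f | ∀ m, (f : R[X]).coeff m ∈ W.1 m}
  add_mem' := by
    intro f g hf hg m
    rw [Subalgebra.coe_add, coeff_add]
    exact add_mem (hf m) (hg m)
  zero_mem' := fun m => by simp
  smul_mem' := by
    intro f g hg m
    rw [smul_eq_mul, Subalgebra.coe_mul, coeff_mul]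
    refine sum_mem fun ij hij => ?_
    rw [← Finset.HasAntidiagonal.mem_antidiagonal.1 hij]
    exact W.pow_mul_le _ _ (Ideal.mul_mem_mul (f.2 ij.1) (hg ij.2))

/-- Testing on monomials recovers the order, so the ascending chain condition passes from the Rees
algebra to families. -/
theorem ReesFamily.le_of_toIdeal_le {I : Ideal R} {V W : ReesFamily I}
    (h : V.toIdeal ≤ W.toIdeal) : V ≤ W := by
  intro m x hx
  have hmem : (⟨monomial m x, reesAlgebra.monomial_mem.2 ((V.2 m).1 hx)⟩ : reesAlgebra I) ∈
      V.toIdeal := by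
    intro k
    change (monomial m x).coeff k ∈ V.1 k
    rw [coeff_monomial]
    split_ifs with hk
    · exact hk ▸ hx
    · exact zero_mem _
  have h2 : (monomial m x).coeff m ∈ W.1 m := h hmem m
  rwa [coeff_monomial, if_pos rfl] at h2

theorem ReesFamily.toIdeal_mono {I : Ideal R} {V W : ReesFamily I} (h : V ≤ W) :
    V.toIdeal ≤ W.toIdeal := fun _ hf m => h m (hf m)

theorem ReesFamily.exists_eq_of_monotone [IsNoetherianRing R] {I : Ideal R}
    (W : ℕ → ReesFamily I) (hW : Monotone W) : ∃ n, ∀ m, n ≤ m → W n = W m := by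
  obtain ⟨n, hn⟩ := monotone_stabilizes_iff_noetherian.2
    (inferInstance : IsNoetherianRing (reesAlgebra I))
    ⟨fun k => (W k).toIdeal, fun i j hij => ReesFamily.toIdeal_mono (hW hij)⟩
  exact ⟨n, fun m hm => le_antisymm (hW hm) (ReesFamily.le_of_toIdeal_le (hn m hm).ge)⟩

/-- If `I` maps each `A m` into `B (m + 1)`, then `A` and `B` agree in large degrees. -/
theorem ReesFamily.eventually_eq_of_mul_le [IsNoetherianRing R] {I : Ideal R}
    {A B : ReesFamily I} (hBA : B ≤ A) (h : ∀ m, I * A.1 m ≤ B.1 (m + 1)) :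
    ∀ᶠ m in atTop, A.1 m = B.1 m := by
  -- `W k` is `A` up to degree `k` and `B` beyond; the hypothesis `h` handles the junction. Where
  -- this ascending chain is stationary, `A` and `B` agree.
  let W : ℕ → ReesFamily I := fun k => ⟨fun m => if m ≤ k then A.1 m else B.1 m, fun m => by
    constructor
    · beta_reduce
      split_ifs
      · exact (A.2 m).1
      · exact (B.2 m).1
    · have h1 : B.1 (m + 1) ≤ if m + 1 ≤ k then A.1 (m + 1) else B.1 (m + 1) := by
        split_ifs
        · exact hBA _
        · exact le_rfl
      refine le_trans ?_ h1
      beta_reduce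
      split_ifs
      · exact h m
      · exact (B.2 m).2⟩
  have hW : Monotone W := by
    intro i j hij m
    change (if m ≤ i then A.1 m else B.1 m) ≤ if m ≤ j then A.1 m else B.1 m
    split_ifs with h1 h2
    · exact le_rfl
    · exact absurd (h1.trans hij) h2
    · exact hBA m
    · exact le_rfl
  obtain ⟨n, hn⟩ := ReesFamily.exists_eq_of_monotone W hW
  refine eventually_atTop.2 ⟨n + 1, fun m hm => ?_⟩
  have h1 : (W n).1 m = (W m).1 m := by rw [hn m (by omega)]
  change (if m ≤ n then A.1 m else B.1 m) = if m ≤ m then A.1 m else B.1 m at h1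
  rw [if_neg (by omega), if_pos le_rfl] at h1
  exact h1.symm

/-- The kernel of multiplication by `a` on `A / B`. -/
def ReesFamily.mulKer {I : Ideal R} (A B : ReesFamily I) (a : R) : ReesFamily I :=
  ⟨fun m => A.1 m ⊓ Submodule.comap (LinearMap.mulLeft R a) (B.1 (m + 1)), fun m => by
    refine ⟨inf_le_left.trans (A.2 m).1,
      Ideal.mul_le.2 fun r hr x hx => Submodule.mem_inf.2 ⟨?_, ?_⟩⟩
    · exact (A.2 m).2 (Ideal.mul_mem_mul hr hx.1)
    · change a * (r * x) ∈ B.1 (m + 1 + 1)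
      rw [mul_left_comm]
      exact (B.2 (m + 1)).2 (Ideal.mul_mem_mul hr hx.2)⟩

/-- The image of multiplication by `a` on `A / B`. -/
def ReesFamily.mulRange {I : Ideal R} (A B : ReesFamily I) {a : R} (ha : a ∈ I) :
    ReesFamily I :=
  -- Multiplication by `a` raises degrees by one, so its image vanishes in degree `0`.
  ⟨fun m => Nat.casesOn m (B.1 0) fun m => Ideal.span {a} * A.1 m ⊔ B.1 (m + 1), fun m => by
    have ha' : Ideal.span {a} ≤ I := (Ideal.span_singleton_le_iff_mem I).2 ha
    cases m with
    | zero => exact ⟨(B.2 0).1, (B.2 0).2.trans le_sup_right⟩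
    | succ m =>
      refine ⟨sup_le ?_ (B.2 _).1, ?_⟩
      · rw [pow_succ']
        exact Ideal.mul_mono ha' (A.2 m).1
      · change I * (Ideal.span {a} * A.1 m ⊔ B.1 (m + 1)) ≤
          Ideal.span {a} * A.1 (m + 1) ⊔ B.1 (m + 1 + 1)
        rw [Ideal.mul_sup, mul_left_comm]
        exact sup_le_sup (Ideal.mul_mono_right (A.2 m).2) (B.2 _).2⟩

/-- **Hilbert–Serre** for subquotients of the Rees algebra. -/
theorem ReesFamily.exists_hilbert_polynomial_aux [IsNoetherianRing R] {I : Ideal R}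
    (s : Finset R) : ∀ (K : Ideal R) (_ : I = Ideal.span (s : Set R) ⊔ K) (A B : ReesFamily I)
      (_ : B ≤ A) (_ : ∀ m, relLength (A.1 m) (B.1 m) ≠ ⊤)
      (_ : ∀ m, K * A.1 m ≤ B.1 (m + 1)),
      ∃ P : ℚ[X], ∀ᶠ m : ℕ in atTop,
        ((relLength (A.1 m) (B.1 m)).toNat : ℚ) = P.eval (m : ℚ) := by
  classical
  induction s using Finset.induction_on with
  | empty =>
    intro K hK A B hBA _ hKA
    simp only [Finset.coe_empty, Ideal.span_empty, bot_sup_eq] at hK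
    subst hK
    refine ⟨0, (ReesFamily.eventually_eq_of_mul_le hBA hKA).mono fun m hm => ?_⟩
    rw [hm, relLength_self]
    simp
  | insert a s _ ih =>
    intro K hK A B hBA hfin hKA
    -- `K` is the part of `I` known to kill `A / B`. The kernel and cokernel of `a` are killed by
    -- `a` as well, so `a` moves into `K`.
    have hK' : I = Ideal.span (s : Set R) ⊔ (Ideal.span {a} ⊔ K) := by
      rw [hK, Finset.coe_insert, Ideal.span_insert, sup_comm (Ideal.span {a}), sup_assoc]
    have haI : a ∈ I := by
      rw [hK]
      exact Submodule.mem_sup_left (Ideal.subset_span (by simp))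
    have hB1 : B ≤ A.mulKer B a := fun m x hx => ⟨hBA m hx, by
      change a * x ∈ B.1 (m + 1)
      exact (B.2 m).2 (Ideal.mul_mem_mul haI hx)⟩
    have h1A : A.mulKer B a ≤ A := fun m => inf_le_left
    have hB2 : B ≤ A.mulRange B haI := fun m => by
      cases m with
      | zero => exact le_rfl
      | succ m => exact le_sup_right
    have h2A : A.mulRange B haI ≤ A := fun m => by
      cases m with
      | zero => exact hBA 0
      | succ m =>
        refine sup_le (le_trans (Ideal.mul_mono_left ?_) (A.2 m).2) (hBA _)
        exact (Ideal.span_singleton_le_iff_mem I).2 haI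
    have e1 : ∀ m, relLength (A.1 m) (B.1 m) = relLength (A.1 m) ((A.mulKer B a).1 m) +
      relLength ((A.mulKer B a).1 m) (B.1 m) := fun m => relLength_eq_add (hB1 m) (h1A m)
    have e2 : ∀ m, relLength (A.1 m) (B.1 m) = relLength (A.1 m) ((A.mulRange B haI).1 m) +
      relLength ((A.mulRange B haI).1 m) (B.1 m) := fun m => relLength_eq_add (hB2 m) (h2A m)
    have e3 : ∀ m, relLength (A.1 m) ((A.mulKer B a).1 m) =
        relLength ((A.mulRange B haI).1 (m + 1)) (B.1 (m + 1)) :=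
      fun m => relLength_inf_comap_mul (A.1 m) (B.1 (m + 1)) a
    have f1 : ∀ m, relLength (A.1 m) ((A.mulKer B a).1 m) ≠ ⊤ ∧
        relLength ((A.mulKer B a).1 m) (B.1 m) ≠ ⊤ := fun m => by
      have h := hfin m
      rw [e1 m] at h
      exact WithTop.add_ne_top.1 h
    have f2 : ∀ m, relLength (A.1 m) ((A.mulRange B haI).1 m) ≠ ⊤ ∧
        relLength ((A.mulRange B haI).1 m) (B.1 m) ≠ ⊤ := fun m => by
      have h := hfin m
      rw [e2 m] at h
      exact WithTop.add_ne_top.1 h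
    obtain ⟨P, hP⟩ := ih _ hK' (A.mulKer B a) B hB1 (fun m => (f1 m).2) (fun m => by
      rw [Ideal.sup_mul]
      refine sup_le (Ideal.mul_le.2 fun r hr x hx => ?_)
        ((Ideal.mul_mono_right (h1A m)).trans (hKA m))
      obtain ⟨c, rfl⟩ := Ideal.mem_span_singleton'.1 hr
      rw [mul_assoc]
      exact Ideal.mul_mem_left _ _ hx.2)
    obtain ⟨Q, hQ⟩ := ih _ hK' A (A.mulRange B haI) h2A (fun m => (f2 m).1) (fun m => by
      rw [Ideal.sup_mul]
      exact sup_le_sup le_rfl (hKA m))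
    -- The first difference of the length at `m` is the cokernel length in degree `m + 1` minus the
    -- kernel length in degree `m`.
    refine exists_polynomial_of_eventually_succ_sub (P := Q.comp (X + 1) - P) ?_
    filter_upwards [hP, (tendsto_add_atTop_nat 1).eventually hQ] with m hm hm'
    rw [eval_sub, eval_comp, eval_add, eval_X, eval_one, ← hm]
    push_cast at hm'
    rw [← hm', e2 (m + 1), e1 m, ENat.toNat_add (f2 _).1 (f2 _).2, ENat.toNat_add (f1 _).1 (f1 _).2,
      e3 m]
    push_cast
    ring

theorem ReesFamily.exists_hilbert_polynomial [IsNoetherianRing R] {I : Ideal R}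
    {A B : ReesFamily I} (hBA : B ≤ A) (hfin : ∀ m, relLength (A.1 m) (B.1 m) ≠ ⊤) :
    ∃ P : ℚ[X], ∀ᶠ m : ℕ in atTop,
      ((relLength (A.1 m) (B.1 m)).toNat : ℚ) = P.eval (m : ℚ) := by
  obtain ⟨s, hs⟩ := IsNoetherian.noetherian I
  exact ReesFamily.exists_hilbert_polynomial_aux s ⊥ (by rw [sup_bot_eq]; exact hs.symm) A B hBA
    hfin (fun m => by rw [Ideal.bot_mul]; exact bot_le)

end Hilbert

section

variable {R : Type u} [CommRing R]

/-! ### Artin–Rees and cancellation of powers of `I` -/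

section ArtinRees

theorem Submodule.mem_smul_top_pi_iff {ι : Type*} [Finite ι] {N : Type v} [AddCommGroup N]
    [Module R N] (I : Ideal R) (f : ι → N) :
    f ∈ I • (⊤ : Submodule R (ι → N)) ↔ ∀ i, f i ∈ I • (⊤ : Submodule R N) := by
  classical
  cases nonempty_fintype ι
  constructor
  · intro hf i
    have h := Submodule.mem_map_of_mem (f := (LinearMap.proj i : (ι → N) →ₗ[R] N)) hf
    rw [Submodule.map_smul''] at h
    exact Submodule.smul_mono (le_refl _) le_top h
  · intro hf
    rw [← Finset.univ_sum_single f]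
    refine sum_mem fun i _ => ?_
    have h := Submodule.mem_map_of_mem (f := LinearMap.single R (fun _ : ι => N) i) (hf i)
    rw [Submodule.map_smul''] at h
    exact Submodule.smul_mono (le_refl _) le_top h

variable [IsNoetherianRing R]

/-- The Artin–Rees lemma for an injective linear map. -/
theorem Ideal.exists_comap_pow_smul_top_eq {L : Type*} {P : Type*} [AddCommGroup L] [Module R L]
    [AddCommGroup P] [Module R P] [Module.Finite R P] (I : Ideal R) (φ : L →ₗ[R] P)
    (hφ : Function.Injective φ) :
    ∃ c : ℕ, ∀ n, c ≤ n → (I ^ n • (⊤ : Submodule R P)).comap φ =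
      I ^ (n - c) • (I ^ c • (⊤ : Submodule R P)).comap φ := by
  obtain ⟨c, hc⟩ := I.exists_pow_inf_eq_pow_smul (LinearMap.range φ)
  refine ⟨c, fun n hn => Submodule.map_injective_of_injective hφ ?_⟩
  rw [Submodule.map_smul'', Submodule.map_comap_eq, Submodule.map_comap_eq, inf_comm, hc n hn,
    inf_comm (LinearMap.range φ)]

/-- Multiplication by generators of `I` embeds `N` in a finite power of `N`, and Artin–Rees applies
to this embedding. -/
theorem Ideal.exists_forall_mem_pow_smul_of_forall_smul_mem {N : Type*} [AddCommGroup N]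
    [Module R N] [Module.Finite R N] (I : Ideal R) (hN : ∀ y : N, (∀ a ∈ I, a • y = 0) → y = 0) :
    ∃ c : ℕ, ∀ n, c ≤ n → ∀ y : N,
      (∀ a ∈ I, a • y ∈ I ^ (n + 1) • (⊤ : Submodule R N)) →
        y ∈ I ^ n • (⊤ : Submodule R N) := by
  obtain ⟨s, hs⟩ := IsNoetherian.noetherian I
  let φ : N →ₗ[R] (s → N) := LinearMap.pi fun a => LinearMap.lsmul R N a
  have key : ∀ (D : Submodule R N) (y : N), (∀ a : s, (a : R) • y ∈ D) → ∀ a ∈ I, a • y ∈ D := by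
    intro D y hy a ha
    rw [← hs] at ha
    induction ha using Submodule.span_induction with
    | mem x hx => exact hy ⟨x, hx⟩
    | zero => rw [zero_smul]; exact zero_mem _
    | add x z _ _ hx hz => rw [add_smul]; exact add_mem hx hz
    | smul r x _ hx => rw [smul_eq_mul, mul_smul]; exact D.smul_mem r hx
  have hφ : Function.Injective φ := by
    refine (injective_iff_map_eq_zero φ).2 fun y hy => hN y ?_
    exact key ⊥ y fun a => congrFun hy a
  obtain ⟨c, hc⟩ := I.exists_comap_pow_smul_top_eq φ hφ
  refine ⟨c, fun n hn y hy => ?_⟩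
  have hy1 : y ∈ (I ^ (n + 1) • (⊤ : Submodule R (s → N))).comap φ := by
    rw [Submodule.mem_comap, Submodule.mem_smul_top_pi_iff]
    exact fun a => hy a (hs ▸ Submodule.subset_span a.2)
  rw [hc (n + 1) (by omega), Nat.sub_add_comm hn, pow_succ, mul_smul] at hy1
  -- One factor `I` is spent to return from the preimage to `I ^ c N`, which leaves the exponent `(n
  -- - c) + c = n`.
  have hle : I • (I ^ c • (⊤ : Submodule R (s → N))).comap φ ≤ I ^ c • (⊤ : Submodule R N) := by
    refine Submodule.smul_le.2 fun a ha z hz => key _ z (fun b => ?_) a ha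
    exact (Submodule.mem_smul_top_pi_iff _ _).1 (Submodule.mem_comap.1 hz) b
  have h2 := Submodule.smul_mono (le_refl _) hle hy1
  rwa [← mul_smul, ← pow_add, Nat.sub_add_cancel hn] at h2

/-- The constant is uniform in `k`: factors are cancelled singly, always at a level `n + k ≥ c`. -/
theorem Ideal.exists_forall_mem_pow_smul_of_forall_pow_smul_mem {N : Type*} [AddCommGroup N]
    [Module R N] [Module.Finite R N] (I : Ideal R) (hN : ∀ y : N, (∀ a ∈ I, a • y = 0) → y = 0) :
    ∃ c : ℕ, ∀ n, c ≤ n → ∀ (k : ℕ) (y : N),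
      (∀ a ∈ I ^ k, a • y ∈ I ^ (n + k) • (⊤ : Submodule R N)) →
        y ∈ I ^ n • (⊤ : Submodule R N) := by
  obtain ⟨c, hc⟩ := I.exists_forall_mem_pow_smul_of_forall_smul_mem hN
  refine ⟨c, fun n hn k => ?_⟩
  induction k with
  | zero =>
    intro y hy
    simpa using hy 1 (by simp)
  | succ k ih =>
    intro y hy
    refine ih y fun b hb => hc (n + k) (by omega) _ fun a ha => ?_
    rw [smul_smul]
    exact hy _ (by rw [pow_succ']; exact Ideal.mul_mem_mul ha hb)

/-- For `Z = (0 :_M I)`, Artin–Rees gives `I^(c+1) M ∩ Z = I (I^c M ∩ Z) ⊆ I Z = 0`. -/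
theorem Ideal.exists_pow_smul_torsion_free {M : Type*} [AddCommGroup M]
    [Module R M] [Module.Finite R M] (I : Ideal R) :
    ∃ c : ℕ, ∀ y ∈ I ^ c • (⊤ : Submodule R M), (∀ a ∈ I, a • y = 0) → y = 0 := by
  let Z : Submodule R M := Submodule.torsionBySet R M I
  have hZ : ∀ y, y ∈ Z ↔ ∀ a ∈ I, a • y = 0 := fun y => by
    rw [Submodule.mem_torsionBySet_iff]
    exact ⟨fun h a ha => h ⟨a, ha⟩, fun h a => h a a.2⟩
  obtain ⟨c, hc⟩ := I.exists_pow_inf_eq_pow_smul Z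
  refine ⟨c + 1, fun y hy hy0 => ?_⟩
  have h : y ∈ I ^ (c + 1) • (⊤ : Submodule R M) ⊓ Z := ⟨hy, (hZ y).2 hy0⟩
  rw [hc (c + 1) (Nat.le_succ c), Nat.add_sub_cancel_left, pow_one] at h
  have hle : I • (I ^ c • (⊤ : Submodule R M) ⊓ Z) ≤ ⊥ :=
    Submodule.smul_le.2 fun a ha z hz => (Submodule.mem_bot R).2 ((hZ z).1 hz.2 a ha)
  exact (Submodule.mem_bot R).1 (hle h)

end ArtinRees

/-! ### Ratliff–Rush ideals of large powers -/

section RatliffRush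

theorem Submodule.smul_mem_smul_of_forall_smul_mem {M : Type*} [AddCommGroup M] [Module R M]
    (I : Ideal R) {D D' : Submodule R M} {x : R} (h : ∀ m ∈ D, x • m ∈ D') :
    ∀ m ∈ I • D, x • m ∈ I • D' := by
  intro m hm
  have h1 := Submodule.mem_map_of_mem (f := LinearMap.lsmul R M x) hm
  rw [Submodule.map_smul''] at h1
  exact Submodule.smul_mono (le_refl _) (Submodule.map_le_iff_le_comap.2 h) h1

theorem IsRegularIdeal.eq_zero_of_forall_pow_mul_eq_zero {I : Ideal R} (hI : IsRegularIdeal I)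
    (k : ℕ) {y : R} (h : ∀ a ∈ I ^ k, a * y = 0) : y = 0 := by
  obtain ⟨x, hx, hx0⟩ := hI
  exact (mul_left_mem_nonZeroDivisors_eq_zero_iff (pow_mem hx0 k)).1 (h _ (Ideal.pow_mem_pow hx k))

variable [IsNoetherianRing R]

/-- The theorem of Ratliff and Rush: `I ^ n` is Ratliff–Rush closed for large `n`. -/
theorem IsRegularIdeal.exists_ratliffRushClosure_pow_eq {I : Ideal R} (hI : IsRegularIdeal I) :
    ∃ c : ℕ, ∀ n, c ≤ n → ratliffRushClosure (I ^ n) = I ^ n := by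
  obtain ⟨c, hc⟩ := I.exists_forall_mem_pow_smul_of_forall_pow_smul_mem (N := R)
    fun y hy => hI.eq_zero_of_forall_pow_mul_eq_zero 1 (by simpa using hy)
  refine ⟨c, fun n hn => le_antisymm (fun x hx => ?_) fun x hx => ?_⟩
  · obtain ⟨k, -, hk⟩ := (mem_ratliffRushClosure _ _).1 hx
    have h := hc n hn (n * k) x fun a ha => by
      rw [smul_eq_mul, smul_eq_mul, Ideal.mul_top, mul_comm a]
      have h1 := hk a (by rwa [← pow_mul])
      rwa [← pow_mul, mul_add_one, add_comm (n * k)] at h1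
    rwa [smul_eq_mul, Ideal.mul_top] at h
  · refine (mem_ratliffRushClosure _ _).2 ⟨1, le_rfl, fun a ha => ?_⟩
    rw [pow_succ']
    exact Ideal.mul_mem_mul hx ha

variable {M : Type v} [AddCommGroup M] [Module R M] [Module.Finite R M]

/-- For a faithful module the ideals `r(I ^ n, M)` form an `I`-stable sequence for large `n`. -/
theorem IsRegularIdeal.exists_ratliffRushIdeal_pow_eq {I : Ideal R} (hI : IsRegularIdeal I)
    (hM : ∀ y : R, (∀ m : M, y • m = 0) → y = 0) :
    ∃ (c : ℕ) (J : Ideal R), ∀ n, c ≤ n → ratliffRushIdeal (I ^ n) M = I ^ (n - c) * J := by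
  -- `M` may have elements killed by `I`; in `N = I^c₀ M` cancellation is available. The goal
  -- becomes `r(I^n, M) = (I^n N : N)` for large `n`, a preimage under the embedding `φ` of `R` in a
  -- power of `N`.
  obtain ⟨c₀, h₀⟩ := I.exists_pow_smul_torsion_free (M := M)
  let N : Submodule R M := I ^ c₀ • ⊤
  obtain ⟨c₁, h₁⟩ := I.exists_forall_mem_pow_smul_of_forall_pow_smul_mem (N := N)
    fun y hy => Subtype.ext (h₀ y y.2 fun a ha => congrArg Subtype.val (hy a ha))
  obtain ⟨t, ht⟩ := (inferInstance : Module.Finite R N).fg_top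
  let φ : R →ₗ[R] (t → N) := LinearMap.pi fun g => LinearMap.toSpanSingleton R N g
  have hspan : ∀ (D : Submodule R N) (x : R), (∀ g : t, x • (g : N) ∈ D) → ∀ y : N, x • y ∈ D := by
    intro D x hx y
    have h : (⊤ : Submodule R N) ≤ D.comap (LinearMap.lsmul R N x) := by
      rw [← ht, Submodule.span_le]
      exact fun g hg => hx ⟨g, hg⟩
    exact h Submodule.mem_top
  have hφ : Function.Injective φ := by
    refine (injective_iff_map_eq_zero φ).2 fun x hx => ?_
    have hx' := hspan ⊥ x fun g => congrFun hx g
    refine hI.eq_zero_of_forall_pow_mul_eq_zero c₀ fun a ha => hM _ fun m => ?_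
    have h := congrArg Subtype.val ((Submodule.mem_bot R).1
      (hx' ⟨a • m, Submodule.smul_mem_smul ha Submodule.mem_top⟩))
    rw [mul_comm, mul_smul]
    exact h
  have hφmem : ∀ (n : ℕ) (x : R), x ∈ (I ^ n • (⊤ : Submodule R (t → N))).comap φ ↔
      ∀ y ∈ N, x • y ∈ I ^ n • N := by
    intro n x
    rw [Submodule.mem_comap, Submodule.mem_smul_top_pi_iff]
    constructor
    · intro h y hy
      exact (Submodule.mem_smul_top_iff _ N _).1 (hspan _ x h ⟨y, hy⟩)
    · intro h g
      exact (Submodule.mem_smul_top_iff _ N _).2 (h _ (g : N).2)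
  obtain ⟨c₂, h₂⟩ := I.exists_comap_pow_smul_top_eq φ hφ
  -- `c₁` serves the cancellation, `c₂` Artin–Rees, and the extra `1` ensures `n ≥ 1`.
  refine ⟨c₁ + c₂ + 1, I ^ (c₁ + 1) * (I ^ c₂ • (⊤ : Submodule R (t → N))).comap φ,
    fun n hn => ?_⟩
  rw [← mul_assoc, ← pow_add, ← smul_eq_mul, show n - (c₁ + c₂ + 1) + (c₁ + 1) = n - c₂ by omega,
    ← h₂ n (by omega)]
  ext x
  rw [mem_ratliffRushIdeal, hφmem]
  constructor
  -- Multiplying by `I^c₀` gives `x I^(nk) N ⊆ I^(n+nk) N`; then `I^(nk)` is cancelled.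
  · rintro ⟨k, -, hk⟩ y hy
    rw [← pow_mul, ← pow_mul] at hk
    refine (Submodule.mem_smul_top_iff _ N (x • ⟨y, hy⟩)).1
      (h₁ n (by omega) (n * k) _ fun a ha => (Submodule.mem_smul_top_iff _ N _).2 ?_)
    change a • x • y ∈ I ^ (n + n * k) • I ^ c₀ • (⊤ : Submodule R M)
    rw [smul_comm a x y, add_comm, ← mul_add_one, ← mul_smul (I ^ _),
      mul_comm (I ^ _), mul_smul (I ^ c₀)]
    have h := Submodule.smul_mem_smul_of_forall_smul_mem (I ^ c₀) hk (a • y) (by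
      rw [← mul_smul, mul_comm, mul_smul]
      exact Submodule.smul_mem_smul ha hy)
    exact h
  · intro h
    have hle : c₀ ≤ n * (c₀ + 1) := by nlinarith
    -- This exponent makes `(I^n)^(c₀+1) M` a multiple of `N = I^c₀ M` by a power of `I`.
    refine ⟨c₀ + 1, by omega, ?_⟩
    have h3 := Submodule.smul_mem_smul_of_forall_smul_mem (I ^ (n * (c₀ + 1) - c₀)) h
    have e1 : I ^ (n * (c₀ + 1) - c₀) • N = (I ^ n) ^ (c₀ + 1) • (⊤ : Submodule R M) := by
      rw [← mul_smul, ← pow_add, Nat.sub_add_cancel hle, pow_mul]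
    have e2 : I ^ (n * (c₀ + 1) - c₀) • I ^ n • N =
        (I ^ n) ^ (c₀ + 1 + 1) • (⊤ : Submodule R M) := by
      rw [pow_succ' _ (c₀ + 1), mul_smul, ← e1, ← mul_smul, mul_comm, mul_smul]
    rwa [e1, e2] at h3

end RatliffRush

end

section

variable {R : Type u} [CommRing R]

/-! ### The trace ideal -/

section Trace

/-- The trace ideal of `M`, generated by the values of all linear forms on `M`. -/
def traceIdeal (R : Type u) [CommRing R] (M : Type v) [AddCommGroup M] [Module R M] : Ideal R :=
  ⨆ φ : M →ₗ[R] R, LinearMap.range φ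

variable {M : Type v} [AddCommGroup M] [Module R M]

theorem apply_mem_traceIdeal (φ : M →ₗ[R] R) (m : M) : φ m ∈ traceIdeal R M :=
  le_iSup (fun φ : M →ₗ[R] R => LinearMap.range φ) φ ⟨m, rfl⟩

theorem traceIdeal_le {J : Ideal R} (h : ∀ (φ : M →ₗ[R] R) (m : M), φ m ∈ J) :
    traceIdeal R M ≤ J := by
  refine iSup_le fun φ => ?_
  rintro _ ⟨m, rfl⟩
  exact h φ m

theorem not_traceIdeal_le_of_free_localization [IsNoetherianRing R] [Module.Finite R M]
    (p : Ideal R) [p.IsPrime] [Nontrivial (LocalizedModule p.primeCompl M)]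
    [Module.Free (Localization.AtPrime p) (LocalizedModule p.primeCompl M)] :
    ¬ traceIdeal R M ≤ p := by
  intro hle
  let b := Module.Free.chooseBasis (Localization.AtPrime p) (LocalizedModule p.primeCompl M)
  obtain ⟨i⟩ := b.index_nonempty
  let g : M →ₗ[R] Localization.AtPrime p :=
    ((b.coord i).restrictScalars R).comp (LocalizedModule.mkLinearMap p.primeCompl M)
  have : Module.FinitePresentation R M := Module.finitePresentation_of_finite R M
  -- With `b i = m / t`, the lift `φ` of `s g` satisfies `φ m = s t` in the localization, a unit, so
  -- `φ m ∉ p`.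
  obtain ⟨φ, s, hφ⟩ := Module.FinitePresentation.exists_lift_of_isLocalizedModule p.primeCompl
    (Algebra.linearMap R (Localization.AtPrime p)) g
  obtain ⟨⟨m, t⟩, hm⟩ := IsLocalizedModule.surj p.primeCompl
    (LocalizedModule.mkLinearMap p.primeCompl M) (b i)
  have hg : g m = algebraMap R (Localization.AtPrime p) t := by
    change b.coord i (LocalizedModule.mkLinearMap p.primeCompl M m) = _
    rw [← hm]
    change b.coord i ((t : R) • b i) = _
    rw [← algebraMap_smul (Localization.AtPrime p) (t : R) (b i), map_smul]
    simp
  have h1 : algebraMap R (Localization.AtPrime p) (φ m) =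
      algebraMap R (Localization.AtPrime p) (s * t) := by
    have h := LinearMap.congr_fun hφ m
    change algebraMap R (Localization.AtPrime p) (φ m) = (s : R) • g m at h
    rw [h, hg, map_mul, Algebra.smul_def]
  have h2 : IsUnit (algebraMap R (Localization.AtPrime p) (φ m)) := by
    rw [h1]
    exact IsLocalization.map_units _ (s * t)
  exact (IsLocalization.AtPrime.isUnit_to_map_iff (Localization.AtPrime p) p (φ m)).1 h2
    (hle (apply_mem_traceIdeal φ m))

theorem mul_mem_ratliffRushClosure_of_mem_traceIdeal {J : Ideal R} {x : R}
    (hx : x ∈ ratliffRushIdeal J M) {a : R} (ha : a ∈ traceIdeal R M) :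
    a * x ∈ ratliffRushClosure J := by
  obtain ⟨k, hk, h⟩ := (mem_ratliffRushIdeal J M x).1 hx
  have key : traceIdeal R M ≤
      Submodule.comap (LinearMap.mulRight R x) (ratliffRushClosure J) := by
    refine traceIdeal_le fun φ m => ?_
    change φ m * x ∈ ratliffRushClosure J
    refine (mem_ratliffRushClosure J _).2 ⟨k, hk, fun b hb => ?_⟩
    have h1 := Submodule.mem_map_of_mem (f := φ)
      (h (b • m) (Submodule.smul_mem_smul hb Submodule.mem_top))
    rw [Submodule.map_smul'', map_smul, map_smul] at h1
    have h2 := Submodule.smul_mono (le_refl (J ^ (k + 1))) (le_top (a := Submodule.map φ ⊤)) h1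
    rw [smul_eq_mul (J ^ (k + 1)), Ideal.mul_top, smul_eq_mul, smul_eq_mul] at h2
    rwa [mul_comm (φ m), mul_assoc, mul_comm (φ m)]
  exact key ha

/-- If the trace ideal lies in no associated prime of `R`, then `M` is faithful. -/
theorem eq_zero_of_forall_smul_eq_zero [IsNoetherianRing R]
    (h : ∀ p ∈ associatedPrimes R R, ¬ traceIdeal R M ≤ p) {y : R} (hy : ∀ m : M, y • m = 0) :
    y = 0 := by
  by_contra hy0
  obtain ⟨p, hp, hle⟩ := exists_le_isAssociatedPrime_of_isNoetherianRing R y hy0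
  refine h p hp (le_trans (traceIdeal_le fun φ m => ?_) hle)
  rw [Submodule.mem_colon_singleton, Submodule.mem_bot, smul_eq_mul, mul_comm, ← smul_eq_mul,
    ← map_smul, hy, map_zero]

end Trace

/-! ### Finite length from a zero-dimensional quotient -/

section FiniteLength

variable [IsNoetherianRing R]

theorem length_ne_top_of_forall_smul_eq_zero {Q : Type*} [AddCommGroup Q] [Module R Q]
    [Module.Finite R Q] (T : Ideal R) (hT : ∀ p : Ideal R, p.IsPrime → T ≤ p → p.IsMaximal)
    (h : ∀ a ∈ T, ∀ x : Q, a • x = 0) : Module.length R Q ≠ ⊤ := by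
  let : Module (R ⧸ T) Q := Module.IsTorsionBySet.module (I := T) fun x a => h a a.2 x
  have : IsScalarTower R (R ⧸ T) Q := Module.IsTorsionBySet.isScalarTower (I := T) _
  have : Ring.KrullDimLE 0 (R ⧸ T) := Ring.KrullDimLE.mk₀ fun P hP => by
    have hmax := hT (P.comap (Ideal.Quotient.mk T)) inferInstance fun a ha => by
      rw [Ideal.mem_comap, Ideal.Quotient.eq_zero_iff_mem.2 ha]
      exact zero_mem _
    have h1 := Ideal.map_eq_top_or_isMaximal_of_surjective (Ideal.Quotient.mk T)
      Ideal.Quotient.mk_surjective hmax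
    rw [Ideal.map_comap_of_surjective _ Ideal.Quotient.mk_surjective] at h1
    exact h1.resolve_left hP.ne_top
  have : IsArtinianRing (R ⧸ T) := IsNoetherianRing.isArtinianRing_of_krullDimLE_zero
  have : Module.Finite (R ⧸ T) Q := Module.Finite.of_restrictScalars_finite R _ _
  have : IsArtinian R Q :=
    isArtinian_of_surjective_algebraMap (R := R ⧸ T) Ideal.Quotient.mk_surjective
  exact Module.length_ne_top

end FiniteLength

/-! ### Maximal ideals in `A*(I)` -/

section AsymptoticPrimes

theorem forall_mul_mem_pow_of_le {I : Ideal R} {y : R} {n i j : ℕ} (hij : i ≤ j)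
    (h : ∀ a ∈ I ^ i, y * a ∈ I ^ (n + i)) : ∀ a ∈ I ^ j, y * a ∈ I ^ (n + j) := by
  obtain ⟨k, rfl⟩ := Nat.exists_eq_add_of_le' hij
  have h1 := Submodule.smul_mem_smul_of_forall_smul_mem (I ^ k) (D := I ^ i) (D' := I ^ (n + i)) h
  intro a ha
  have h2 := h1 a (by rwa [smul_eq_mul, ← pow_add])
  rwa [smul_eq_mul, ← pow_add, smul_eq_mul, add_left_comm] at h2

/-- For `n ≥ 1` the powers of `I ^ n` are cofinal among those of `I`. -/
theorem mem_ratliffRushClosure_pow {I : Ideal R} {n : ℕ} (hn : 1 ≤ n) {y : R} :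
    y ∈ ratliffRushClosure (I ^ n) ↔ ∃ j, ∀ a ∈ I ^ j, y * a ∈ I ^ (n + j) := by
  rw [mem_ratliffRushClosure]
  constructor
  · rintro ⟨k, -, h⟩
    rw [← pow_mul, ← pow_mul, mul_add_one, add_comm] at h
    exact ⟨n * k, h⟩
  · rintro ⟨j, h⟩
    refine ⟨j + 1, by omega, ?_⟩
    rw [← pow_mul, ← pow_mul, mul_add_one n (j + 1), add_comm _ n]
    exact forall_mul_mem_pow_of_le (by nlinarith) h

/-- The closure is finitely generated, so the largest exponent among generators serves all elements.
-/
theorem exists_forall_mem_ratliffRushClosure_pow [IsNoetherianRing R] (I : Ideal R) {n : ℕ}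
    (hn : 1 ≤ n) : ∃ j, ∀ y ∈ ratliffRushClosure (I ^ n), ∀ a ∈ I ^ j, y * a ∈ I ^ (n + j) := by
  obtain ⟨s, hs⟩ := IsNoetherian.noetherian (ratliffRushClosure (I ^ n))
  have h : ∀ y ∈ s, ∃ j, ∀ a ∈ I ^ j, y * a ∈ I ^ (n + j) := fun y hy =>
    (mem_ratliffRushClosure_pow hn).1 (hs ▸ Submodule.subset_span hy)
  choose! f hf using h
  refine ⟨s.sup f, fun y hy a ha => ?_⟩
  rw [← hs] at hy
  induction hy using Submodule.span_induction with
  | mem x hx => exact forall_mul_mem_pow_of_le (Finset.le_sup hx) (hf x hx) a ha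
  | zero => rw [zero_mul]; exact zero_mem _
  | add x z _ _ hx hz => rw [add_mul]; exact add_mem hx hz
  | smul r x _ hx => rw [smul_eq_mul, mul_assoc]; exact Ideal.mul_mem_left _ r hx

/-- A maximal ideal that is associated to `R / (I ^ n)~` belongs to `A*(I)`. -/
theorem mem_asymptoticPrimes_of_isMaximal [IsNoetherianRing R] {I : Ideal R} {n : ℕ} (hn : 1 ≤ n)
    {p : Ideal R} (hp : p.IsMaximal)
    (hass : p ∈ associatedPrimes R (R ⧸ ratliffRushClosure (I ^ n))) :
    p ∈ asymptoticPrimes I := by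
  obtain ⟨-, y, hy⟩ := isAssociatedPrime_iff.1 hass
  obtain ⟨y, rfl⟩ := Ideal.Quotient.mk_surjective y
  have hpy : ∀ a, a ∈ p ↔ a * y ∈ ratliffRushClosure (I ^ n) := by
    intro a
    rw [hy, Submodule.mem_colon_singleton, Submodule.mem_bot, ← Ideal.Quotient.eq_zero_iff_mem]
    rfl
  have hy0 : y ∉ ratliffRushClosure (I ^ n) := fun h =>
    hp.ne_top ((Ideal.eq_top_iff_one p).2 ((hpy 1).2 (by rwa [one_mul])))
  obtain ⟨j, hj⟩ := exists_forall_mem_ratliffRushClosure_pow I hn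
  refine eventually_atTop.2 ⟨n + j, fun N hN => ?_⟩
  obtain ⟨i, rfl⟩ := Nat.exists_eq_add_of_le (show n ≤ N by omega)
  -- Since `i ≥ j`, `p y ⊆ (I^n)~` gives `p y b ⊆ I^(n+i)`. The annihilator of the class of `y b` is
  -- thus proper and contains the maximal ideal `p`.
  have hex : ∃ b ∈ I ^ i, y * b ∉ I ^ (n + i) := by
    by_contra! hcon
    exact hy0 ((mem_ratliffRushClosure_pow hn).2 ⟨i, hcon⟩)
  obtain ⟨b, hb, hyb⟩ := hex
  refine isAssociatedPrime_iff.2 ⟨hp.isPrime, Ideal.Quotient.mk _ (y * b), ?_⟩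
  have hcol : ∀ a, a ∈ (⊥ : Submodule R (R ⧸ I ^ (n + i))).colon
      {Ideal.Quotient.mk (I ^ (n + i)) (y * b)} ↔ a * (y * b) ∈ I ^ (n + i) := by
    intro a
    rw [Submodule.mem_colon_singleton, Submodule.mem_bot, ← Ideal.Quotient.eq_zero_iff_mem]
    rfl
  refine hp.eq_of_le (fun h => hyb ?_) fun a ha => (hcol a).2 ?_
  · have h1 := (hcol 1).1 (h ▸ Submodule.mem_top)
    rwa [one_mul] at h1
  · rw [← mul_assoc]
    exact forall_mul_mem_pow_of_le (by omega) (hj _ ((hpy a).1 ha)) b hb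

end AsymptoticPrimes

/-! ### Assembly -/

section Main

variable [IsNoetherianRing R] {M : Type v} [AddCommGroup M] [Module R M]

theorem relLength_ratliffRush_ne_top
    (hT : ∀ p : Ideal R, p.IsPrime → traceIdeal R M ≤ p → p.IsMaximal) (J : Ideal R) :
    relLength (ratliffRushIdeal J M) (ratliffRushClosure J) ≠ ⊤ := by
  refine length_ne_top_of_forall_smul_eq_zero (traceIdeal R M) hT fun a ha x => ?_
  obtain ⟨x, rfl⟩ := Submodule.Quotient.mk_surjective _ x
  rw [← Submodule.Quotient.mk_smul, Submodule.Quotient.mk_eq_zero]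
  exact mul_mem_ratliffRushClosure_of_mem_traceIdeal x.2 ha

theorem exists_polynomial_relLength_ratliffRush [Module.Finite R M]
    (hT : ∀ p : Ideal R, p.IsPrime → traceIdeal R M ≤ p → p.IsMaximal)
    (hM : ∀ y : R, (∀ m : M, y • m = 0) → y = 0) {I : Ideal R} (hI : IsRegularIdeal I) :
    ∃ P : ℚ[X], ∀ᶠ n : ℕ in atTop,
      ((relLength (ratliffRushIdeal (I ^ n) M) (ratliffRushClosure (I ^ n))).toNat : ℚ) =
        P.eval (n : ℚ) := by
  obtain ⟨c, J, hJ⟩ := hI.exists_ratliffRushIdeal_pow_eq hM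
  obtain ⟨d, hd⟩ := hI.exists_ratliffRushClosure_pow_eq
  -- The shift by `c + d` puts every degree `m ≥ 0` past both thresholds; it is undone in the final
  -- polynomial.
  have hA : ∀ m, I ^ m * (I ^ d * J) = ratliffRushIdeal (I ^ (m + (c + d))) M := fun m => by
    rw [hJ _ (by omega), ← mul_assoc, ← pow_add, show m + (c + d) - c = m + d by omega]
  have hB : ∀ m, I ^ (m + (c + d)) = ratliffRushClosure (I ^ (m + (c + d))) := fun m =>
    (hd _ (by omega)).symm
  let A : ReesFamily I := ⟨fun m => I ^ m * (I ^ d * J), fun m => ⟨Ideal.mul_le_left, by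
    beta_reduce
    rw [pow_succ', mul_assoc]⟩⟩
  let B : ReesFamily I := ⟨fun m => I ^ (m + (c + d)), fun m =>
    ⟨Ideal.pow_le_pow_right (by omega), by
      beta_reduce
      rw [← pow_succ', add_right_comm]⟩⟩
  have hAB : ∀ m, relLength (A.1 m) (B.1 m) =
      relLength (ratliffRushIdeal (I ^ (m + (c + d))) M)
        (ratliffRushClosure (I ^ (m + (c + d)))) := fun m =>
    congrArg₂ relLength (hA m) (hB m)
  obtain ⟨P, hP⟩ := ReesFamily.exists_hilbert_polynomial (A := A) (B := B)
    (fun m => (hB m).trans_le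
      ((ratliffRushClosure_le_ratliffRushIdeal _ _).trans (hA m).ge))
    (fun m => by
      rw [hAB]
      exact relLength_ratliffRush_ne_top hT _)
  refine ⟨P.comp (X - C ((c + d : ℕ) : ℚ)), ?_⟩
  filter_upwards [(tendsto_sub_atTop_nat (c + d)).eventually hP, eventually_ge_atTop (c + d)]
    with n hn hle
  rw [hAB, Nat.sub_add_cancel hle, Nat.cast_sub hle] at hn
  rw [hn, eval_comp, eval_sub, eval_X, eval_C]

theorem ratliffRushIdeal_pow_eq_of_asymptoticPrimes
    (hT : ∀ p : Ideal R, p.IsPrime → traceIdeal R M ≤ p → p.IsMaximal) {I : Ideal R}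
    (hI : asymptoticPrimes I ∩ maxIdeals R = ∅) {n : ℕ} (hn : 1 ≤ n) :
    ratliffRushIdeal (I ^ n) M = ratliffRushClosure (I ^ n) := by
  refine le_antisymm (fun x hx => ?_) (ratliffRushClosure_le_ratliffRushIdeal _ _)
  by_contra hx0
  obtain ⟨p, hp, hle⟩ := exists_le_isAssociatedPrime_of_isNoetherianRing R
    (Ideal.Quotient.mk (ratliffRushClosure (I ^ n)) x)
    (fun h => hx0 (Ideal.Quotient.eq_zero_iff_mem.1 h))
  have hmax : p.IsMaximal := hT p hp.isPrime fun a ha => hle <| by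
    rw [Submodule.mem_colon_singleton, Submodule.mem_bot]
    exact Ideal.Quotient.eq_zero_iff_mem.2 (mul_mem_ratliffRushClosure_of_mem_traceIdeal hx ha)
  exact Set.eq_empty_iff_forall_notMem.1 hI p ⟨mem_asymptoticPrimes_of_isMaximal hn hmax hp, hmax⟩

end Main

end

theorem theorem6p6 {R : Type u} [CommRing R] [IsNoetherianRing R]
    {M : Type v} [AddCommGroup M] [Module R M] [Module.Finite R M]
    (hR : associatedPrimes R R ∩ maxIdeals R = ∅)
    (hM : ∀ (p : Ideal R) [p.IsPrime], ¬ p.IsMaximal →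
      Nontrivial (LocalizedModule p.primeCompl M) ∧
      Module.Free (Localization.AtPrime p) (LocalizedModule p.primeCompl M))
    (I : Ideal R) (hI : IsRegularIdeal I) :
    (∃ l : ℕ → ℕ, (∀ n : ℕ, 1 ≤ n → ratliffRushLength (I ^ n) M = (l n : ℕ∞)) ∧
      ∃ P : ℚ[X], ∀ᶠ n : ℕ in atTop, (l n : ℚ) = P.eval (n : ℚ)) ∧
    (asymptoticPrimes I ∩ maxIdeals R = ∅ →
      ∀ n : ℕ, 1 ≤ n → ratliffRushIdeal (I ^ n) M = ratliffRushClosure (I ^ n)) := by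
  have hT : ∀ p : Ideal R, p.IsPrime → traceIdeal R M ≤ p → p.IsMaximal := by
    intro p hp hle
    by_contra hmax
    obtain ⟨_, _⟩ := hM p hmax
    exact not_traceIdeal_le_of_free_localization p hle
  have hfaith : ∀ y : R, (∀ m : M, y • m = 0) → y = 0 := fun y hy =>
    eq_zero_of_forall_smul_eq_zero (fun p hp hle =>
      Set.eq_empty_iff_forall_notMem.1 hR p ⟨hp, hT p hp.isPrime hle⟩) hy
  refine ⟨⟨fun n => (relLength (ratliffRushIdeal (I ^ n) M) (ratliffRushClosure (I ^ n))).toNat,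
    fun n _ => (ENat.natCast_toNat (relLength_ratliffRush_ne_top hT _)).symm,
    exists_polynomial_relLength_ratliffRush hT hfaith hI⟩, fun h n hn =>
    ratliffRushIdeal_pow_eq_of_asymptoticPrimes hT h hn⟩
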